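/- For $\ell,n,m\in\mathbb{N}_0$ let $\Sigma_{\ell,n,m}$ be the set of triples $[E,A,B]$ with $E,A\in\mathbb{R}^{\ell\times n}$, $B\in\mathbb{R}^{\ell\times m}$. A system $[E,A,B]\in\Sigma_{\ell,n,m}$ is in quasi P-feedback form (QPFF) if $$[E,A,B]=\left[\begin{bmatrix}E_{11}&E_{12}&E_{13}\\0&E_{22}&E_{23}\\0&0&E_{33}\end{bmatrix},\begin{bmatrix}A_{11}&A_{12}&A_{13}\\0&A_{22}&A_{23}\\0&0&A_{33}\end{bmatrix},\begin{bmatrix}B_{11}&0&B_{13}\\0&0&0\\0&0&B_{33}\end{bmatrix}\right],$$ with row block sizes $\ell_1,\ell_2,\ell_3$, column block sizes $n_1,n_2,n_3$ of $E$ and $A$, and column block sizes $m_1,m_2,m_3$ of $B$ (all of them nonnegative integers), where (i) $E_{11},A_{11}\in\mathbb{R}^{\ell_1\times n_1}$ and $B_{11}\in\mathbb{R}^{\ell_1\times m_1}$ satisfy $\ell_1<n_1+m_1$ or $\ell_1=n_1=m_1=0$ (void block), $\operatorname{rk}E_{11}=\ell_1$, $\operatorname{rk}_{\mathbb{C}}[\lambda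 E_{11}-A_{11},B_{11}]=\ell_1$ for all $\lambda\in\mathbb{C}$, and $\operatorname{rk}B_{11}=m_1$; (ii) $\ell_2=n_2$ and $E_{22}\in\mathbb{R}^{n_2\times n_2}$ is invertible; (iii) $E_{33},A_{33}\in\mathbb{R}^{\ell_3\times n_3}$ and $B_{33}\in\mathbb{R}^{\ell_3\times m_3}$ satisfy $\operatorname{rk}_{\mathbb{C}}[\lambda E_{33}-A_{33},B_{33}]=n_3+m_3$ for all $\lambda\in\mathbb{C}$. The QPFF is called decoupled if $E_{12},E_{13},E_{23},A_{12},A_{13},A_{23},B_{13}$ are all zero. **Proposition.** Let $[E,A,B]\in\Sigma_{\ell,n,m}$ be in QPFF, and let $[\hat E,\hat A,\hat B]\in\Sigma_{\ell,n,m}$ be the decoupled QPFF with the same block sizes and the same diagonal blocks. Then $[E,A,B]$ is P-feedback equivalent to $[\hat E,\hat A,\hat B]$ with $V=I_m$: there exist invertible $S\in\mathbb{R}^{\ell\times\ell}$ and $T\in\mathbb{R}^{n\times n}$ and a matrix $F\in\mathbb{R}^{m\times n}$ such that, as polynomial matrices in $s$, $$[\,sE-A,\;-B\,]=S\,[\,s\hat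 E-\hat A,\;-\hat B\,]\begin{bmatrix}T&0\\F&I_m\end{bmatrix}.$$ -/

import Mathlib

open Matrix Polynomial

/-- A system `[E, A, B]` in `Σ_{ℓ,n,m}`: real matrices `E, A` of size `ℓ × n` and `B` of size
`ℓ × m`, standing for `E x' = A x + B u`. Sizes may be zero. -/
@[ext]
structure DAESystem (ℓ n m : ℕ) where
  E : Matrix (Fin ℓ) (Fin n) ℝ
  A : Matrix (Fin ℓ) (Fin n) ℝ
  B : Matrix (Fin ℓ) (Fin m) ℝ

namespace DAESystem

variable {ℓ n m : ℕ}

/-- The polynomial matrix `[sE - A, -B]`, with `s` the indeterminate of `ℝ[X]`. -/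
noncomputable def pencil (sys : DAESystem ℓ n m) : Matrix (Fin ℓ) (Fin n ⊕ Fin m) ℝ[X] :=
  fromCols ((X : ℝ[X]) • sys.E.map C - sys.A.map C) (-(sys.B.map C))

/-- The complex matrix `[λE - A, B]`. -/
noncomputable def complexPencil (sys : DAESystem ℓ n m) (μ : ℂ) :
    Matrix (Fin ℓ) (Fin n ⊕ Fin m) ℂ :=
  fromCols (μ • sys.E.map Complex.ofReal - sys.A.map Complex.ofReal) (sys.B.map Complex.ofReal)

/-- `sys₁` is P-feedback equivalent to `sys₂` through the invertible matrices `S, T, V` and the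
feedback matrix `F`:  `[sE₁ - A₁, -B₁] = S [sE₂ - A₂, -B₂] [T, 0; F, V]`. -/
def PFeedbackEquivVia (sys₁ sys₂ : DAESystem ℓ n m) (S : GL (Fin ℓ) ℝ) (T : GL (Fin n) ℝ)
    (V : GL (Fin m) ℝ) (F : Matrix (Fin m) (Fin n) ℝ) : Prop :=
  sys₁.pencil =
    (S : Matrix (Fin ℓ) (Fin ℓ) ℝ).map C * sys₂.pencil *
      (fromBlocks (T : Matrix (Fin n) (Fin n) ℝ) 0 F (V : Matrix (Fin m) (Fin m) ℝ)).map C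

end DAESystem

/-- Block sizes of a quasi P-feedback form. The second diagonal block of `E` and `A` is square, so
its number of rows `ℓ₂` is `n₂`. -/
structure QPFFSizes where
  (ℓ₁ n₁ m₁ n₂ m₂ ℓ₃ n₃ m₃ : ℕ)

/-- The diagonal blocks `[E₁₁, A₁₁, B₁₁]`, `[E₂₂, A₂₂]`, `[E₃₃, A₃₃, B₃₃]`. -/
structure QPFFDiag (d : QPFFSizes) where
  sys₁₁ : DAESystem d.ℓ₁ d.n₁ d.m₁
  E₂₂ : Matrix (Fin d.n₂) (Fin d.n₂) ℝ
  A₂₂ : Matrix (Fin d.n₂) (Fin d.n₂) ℝ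
  sys₃₃ : DAESystem d.ℓ₃ d.n₃ d.m₃

/-- The off-diagonal blocks. -/
structure QPFFOff (d : QPFFSizes) where
  E₁₂ : Matrix (Fin d.ℓ₁) (Fin d.n₂) ℝ
  E₁₃ : Matrix (Fin d.ℓ₁) (Fin d.n₃) ℝ
  E₂₃ : Matrix (Fin d.n₂) (Fin d.n₃) ℝ
  A₁₂ : Matrix (Fin d.ℓ₁) (Fin d.n₂) ℝ
  A₁₃ : Matrix (Fin d.ℓ₁) (Fin d.n₃) ℝ
  A₂₃ : Matrix (Fin d.n₂) (Fin d.n₃) ℝ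
  B₁₃ : Matrix (Fin d.ℓ₁) (Fin d.m₃) ℝ

/-- All off-diagonal blocks vanish. -/
def QPFFOff.zero (d : QPFFSizes) : QPFFOff d := ⟨0, 0, 0, 0, 0, 0, 0⟩

/-- The requirements on the diagonal blocks of a quasi P-feedback form. The inequality
`ℓ₁ < n₁ + m₁` is asked of a first block that is present; the block may also be void, that is,
have no rows and no columns. (The rank conditions alone already force one of the two.) -/
structure QPFFDiag.Admissible {d : QPFFSizes} (D : QPFFDiag d) : Prop where
  size₁ : d.ℓ₁ < d.n₁ + d.m₁ ∨ (d.ℓ₁ = 0 ∧ d.n₁ = 0 ∧ d.m₁ = 0)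
  rank_E₁₁ : D.sys₁₁.E.rank = d.ℓ₁
  rank_pencil₁₁ : ∀ μ : ℂ, (D.sys₁₁.complexPencil μ).rank = d.ℓ₁
  rank_B₁₁ : D.sys₁₁.B.rank = d.m₁
  isUnit_E₂₂ : IsUnit D.E₂₂
  rank_pencil₃₃ : ∀ μ : ℂ, (D.sys₃₃.complexPencil μ).rank = d.n₃ + d.m₃

/-- The order-preserving splitting of `k = k₁ + k₂ + k₃` indices into three consecutive groups. -/
def splitThree {k k₁ k₂ k₃ : ℕ} (h : k₁ + (k₂ + k₃) = k) : Fin k ≃ Fin k₁ ⊕ (Fin k₂ ⊕ Fin k₃) :=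
  ((Equiv.sumCongr (Equiv.refl (Fin k₁)) finSumFinEquiv).trans
    (finSumFinEquiv.trans (finCongr h))).symm

/-- The block upper triangular matrix with rows `[M₁₁, M₁₂, M₁₃]`, `[0, M₂₂, M₂₃]`,
`[0, 0, M₃₃]`, on three groups of row and of column indices. -/
def upperBlocks {r₁ r₂ r₃ c₁ c₂ c₃ : ℕ}
    (M₁₁ : Matrix (Fin r₁) (Fin c₁) ℝ) (M₁₂ : Matrix (Fin r₁) (Fin c₂) ℝ)
    (M₁₃ : Matrix (Fin r₁) (Fin c₃) ℝ) (M₂₂ : Matrix (Fin r₂) (Fin c₂) ℝ)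
    (M₂₃ : Matrix (Fin r₂) (Fin c₃) ℝ) (M₃₃ : Matrix (Fin r₃) (Fin c₃) ℝ) :
    Matrix (Fin r₁ ⊕ (Fin r₂ ⊕ Fin r₃)) (Fin c₁ ⊕ (Fin c₂ ⊕ Fin c₃)) ℝ :=
  fromBlocks M₁₁ (fromCols M₁₂ M₁₃) 0 (fromBlocks M₂₂ M₂₃ 0 M₃₃)

/-- The system assembled from its blocks:
`E = [E₁₁, E₁₂, E₁₃; 0, E₂₂, E₂₃; 0, 0, E₃₃]`, `A = [A₁₁, A₁₂, A₁₃; 0, A₂₂, A₂₃; 0, 0, A₃₃]`,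
`B = [B₁₁, 0, B₁₃; 0, 0, 0; 0, 0, B₃₃]`. -/
def QPFFDiag.assemble {d : QPFFSizes} (D : QPFFDiag d) (O : QPFFOff d) {ℓ n m : ℕ}
    (hℓ : d.ℓ₁ + (d.n₂ + d.ℓ₃) = ℓ) (hn : d.n₁ + (d.n₂ + d.n₃) = n)
    (hm : d.m₁ + (d.m₂ + d.m₃) = m) : DAESystem ℓ n m where
  E := (upperBlocks D.sys₁₁.E O.E₁₂ O.E₁₃ D.E₂₂ O.E₂₃ D.sys₃₃.E).submatrix
    (splitThree hℓ) (splitThree hn)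
  A := (upperBlocks D.sys₁₁.A O.A₁₂ O.A₁₃ D.A₂₂ O.A₂₃ D.sys₃₃.A).submatrix
    (splitThree hℓ) (splitThree hn)
  B := (upperBlocks D.sys₁₁.B (0 : Matrix (Fin d.ℓ₁) (Fin d.m₂) ℝ) O.B₁₃
      (0 : Matrix (Fin d.n₂) (Fin d.m₂) ℝ) 0 D.sys₃₃.B).submatrix
    (splitThree hℓ) (splitThree hm)

namespace DAESystem

variable {ℓ n m : ℕ}

/-- `sys` is in quasi P-feedback form with diagonal blocks `D`. -/
def IsQPFFWith (sys : DAESystem ℓ n m) {d : QPFFSizes} (D : QPFFDiag d) : Prop :=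
  D.Admissible ∧ ∃ (O : QPFFOff d) (hℓ : d.ℓ₁ + (d.n₂ + d.ℓ₃) = ℓ)
    (hn : d.n₁ + (d.n₂ + d.n₃) = n) (hm : d.m₁ + (d.m₂ + d.m₃) = m),
    sys = D.assemble O hℓ hn hm

/-- `sys` is in decoupled quasi P-feedback form with diagonal blocks `D`. -/
def IsDecoupledQPFFWith (sys : DAESystem ℓ n m) {d : QPFFSizes} (D : QPFFDiag d) : Prop :=
  D.Admissible ∧ ∃ (hℓ : d.ℓ₁ + (d.n₂ + d.ℓ₃) = ℓ)
    (hn : d.n₁ + (d.n₂ + d.n₃) = n) (hm : d.m₁ + (d.m₂ + d.m₃) = m),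
    sys = D.assemble (QPFFOff.zero d) hℓ hn hm

end DAESystem

/-! Take `S` and `T` block unit upper triangular and let `F` have the single nonzero block `F₁₂`.
Comparing blocks gives a pair of equations in each of the positions (1,2), (2,3), (1,3). In each,
the `E`-equation eliminates one unknown, by the inverse of `E₂₂` or a right inverse of `E₁₁`. What
remains is a generalized Sylvester equation `X A - M X E = R`, transposed in position (1,2), with
the input matrix absorbed into the pencil.

Such an equation is solvable for every `R` (`exists_mul_sub_mul_mul_eq`) because its adjoint is
injective. Injectivity holds because a solution of `A Y = E Y M` annihilates every generalized
eigenspace of `M` (`eq_zero_of_mul_eq_mul_mul`). -/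

open Module.End in
/-- A homogeneous Sylvester equation `A Y = E Y M` has only the trivial solution when the pencil
`μ E - A` is injective for every `μ`. -/
theorem eq_zero_of_mul_eq_mul_mul {p q r : Type*} [Fintype p] [Fintype q] [Fintype r]
    [DecidableEq r] {A E : Matrix p q ℂ} {M : Matrix r r ℂ} {Y : Matrix q r ℂ}
    (hinj : ∀ (μ : ℂ) (v : q → ℂ), (μ • E - A) *ᵥ v = 0 → v = 0)
    (hY : A * Y = E * Y * M) : Y = 0 := by
  have key : ∀ (μ : ℂ) (k : ℕ) (w : r → ℂ),
      ((M.toLin' - algebraMap ℂ (Module.End ℂ (r → ℂ)) μ) ^ k) w = 0 → Y *ᵥ w = 0 := by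
    intro μ k
    induction k with
    | zero => intro w hw; simp_all
    | succ k ih =>
      intro w hw
      rw [pow_succ, Module.End.mul_apply] at hw
      have h := ih _ hw
      have hM : Y *ᵥ (M *ᵥ w) = μ • Y *ᵥ w := by
        simpa [Matrix.mulVec_sub, sub_eq_zero, Module.algebraMap_end_apply, Matrix.mulVec_smul]
          using h
      -- `Y M w = μ Y w` turns `A Y w = E Y M w` into `(μ E - A) Y w = 0`.
      apply hinj μ
      have h2 := congrArg (fun Z => Z *ᵥ w) hY
      simp only [← Matrix.mulVec_mulVec] at h2
      rw [hM] at h2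
      rw [Matrix.sub_mulVec, h2, Matrix.mulVec_smul, Matrix.smul_mulVec, sub_self]
  have htop : LinearMap.ker Y.toLin' = ⊤ := by
    rw [eq_top_iff, ← iSup_maxGenEigenspace_eq_top M.toLin']
    refine iSup_le fun μ w hw => ?_
    obtain ⟨k, hk⟩ := mem_maxGenEigenspace _ _ _ |>.1 hw
    rw [LinearMap.mem_ker, Matrix.toLin'_apply]
    refine key μ k w ?_
    simpa [Algebra.algebraMap_eq_smul_one] using hk
  exact Matrix.toLin'.map_eq_zero_iff.1 (LinearMap.ker_eq_top.1 htop)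

theorem Matrix.mulVec_surjective_of_rank_eq {K p q : Type*} [Field K] [Fintype p] [Fintype q]
    [DecidableEq q] {A : Matrix p q K} (h : A.rank = Fintype.card p) :
    Function.Surjective A.mulVec := by
  have : LinearMap.range A.mulVecLin = ⊤ := by
    apply Submodule.eq_top_of_finrank_eq
    rw [Module.finrank_fintype_fun_eq_card, ← h]
    rfl
  exact LinearMap.range_eq_top.1 this

theorem Matrix.rank_eq_of_mulVec_injective {K p q : Type*} [Field K] [Fintype p] [Fintype q]
    [DecidableEq q] {A : Matrix p q K} (h : Function.Injective A.mulVec) :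
    A.rank = Fintype.card q := by
  have := LinearMap.finrank_range_of_inj (f := A.mulVecLin) h
  rwa [Module.finrank_fintype_fun_eq_card] at this

theorem Matrix.mulVec_injective_of_rank_eq {K p q : Type*} [Field K] [Fintype p] [Fintype q]
    [DecidableEq q] {A : Matrix p q K} (h : A.rank = Fintype.card q) :
    Function.Injective A.mulVec := by
  have h1 := LinearMap.finrank_range_add_finrank_ker A.mulVecLin
  have h2 : Module.finrank K (LinearMap.range A.mulVecLin) = Fintype.card q := h
  rw [Module.finrank_fintype_fun_eq_card, h2, Nat.add_eq_left, Submodule.finrank_eq_zero] at h1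
  exact LinearMap.ker_eq_bot.1 h1

/-- The Sylvester equation `X A - M X E = R` is solvable for every right-hand side when the
complex pencil `μ E - A` has full column rank for every `μ`. -/
theorem exists_mul_sub_mul_mul_eq {p q r : Type*} [Fintype p] [Fintype q] [Fintype r]
    [DecidableEq p] [DecidableEq q] [DecidableEq r] {A E : Matrix p q ℝ}
    (hrank : ∀ μ : ℂ,
      (μ • E.map Complex.ofReal - A.map Complex.ofReal).rank = Fintype.card q)
    (M : Matrix r r ℝ) (R : Matrix r q ℝ) : ∃ X : Matrix r p ℝ, X * A - M * X * E = R := by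
  let L : Matrix (q × r) (p × r) ℝ := kroneckerMap (· * ·) Aᵀ 1 - kroneckerMap (· * ·) Eᵀ M
  have hL : ∀ X : Matrix r p ℝ, L *ᵥ X.vec = (X * A - M * X * E).vec := by
    intro X
    simp [L, Matrix.sub_mulVec, Matrix.kronecker_mulVec_vec, Matrix.vec_sub]
  have hLt : ∀ Y : Matrix r q ℝ, Lᵀ *ᵥ Y.vec = (Y * Aᵀ - Mᵀ * Y * Eᵀ).vec := by
    intro Y
    have : Lᵀ = kroneckerMap (· * ·) A 1 - kroneckerMap (· * ·) E Mᵀ := by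
      simp [L, Matrix.transpose_sub, ← Matrix.kroneckerMap_transpose]
    simp [this, Matrix.sub_mulVec, Matrix.kronecker_mulVec_vec, Matrix.vec_sub]
  -- Surjectivity of the vectorized operator follows from injectivity of its transpose.
  -- Complexification is needed because the real generalized eigenspaces of `M` need not span.
  have hinj : Function.Injective Lᵀ.mulVec := by
    rw [← Matrix.coe_mulVecLin]
    refine (injective_iff_map_eq_zero _).2 fun y hy => ?_
    obtain ⟨Y, rfl⟩ := Matrix.vec_bijective.surjective y
    rw [Matrix.mulVecLin_apply, hLt, Matrix.vec_eq_zero_iff, sub_eq_zero] at hy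
    rw [Matrix.vec_eq_zero_iff]
    have hc : (Yᵀ).map Complex.ofReal = 0 := by
      refine eq_zero_of_mul_eq_mul_mul (A := A.map Complex.ofReal) (E := E.map Complex.ofReal)
        (M := M.map Complex.ofReal) (fun μ v hv => ?_) ?_
      · exact Matrix.mulVec_injective_of_rank_eq (hrank μ) (hv.trans (Matrix.mulVec_zero _).symm)
      · have := congrArg (fun Z => Zᵀ.map (Complex.ofRealHom)) hy
        simp only [Matrix.transpose_mul, Matrix.transpose_transpose, Matrix.map_mul,
          ← Matrix.mul_assoc] at this
        exact this
    ext i j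
    simpa using congrFun (congrFun hc j) i
  obtain ⟨x, hx⟩ := Matrix.mulVec_surjective_of_rank_eq (A := L)
    (by rw [← Matrix.rank_transpose, Matrix.rank_eq_of_mulVec_injective hinj]) R.vec
  obtain ⟨X, rfl⟩ := Matrix.vec_bijective.surjective x
  exact ⟨X, Matrix.vec_inj.1 ((hL X).symm.trans hx)⟩

theorem upperBlocks_mul {r₁ r₂ r₃ c₁ c₂ c₃ k₁ k₂ k₃ : ℕ}
    (M₁₁ : Matrix (Fin r₁) (Fin c₁) ℝ) (M₁₂ : Matrix (Fin r₁) (Fin c₂) ℝ)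
    (M₁₃ : Matrix (Fin r₁) (Fin c₃) ℝ) (M₂₂ : Matrix (Fin r₂) (Fin c₂) ℝ)
    (M₂₃ : Matrix (Fin r₂) (Fin c₃) ℝ) (M₃₃ : Matrix (Fin r₃) (Fin c₃) ℝ)
    (N₁₁ : Matrix (Fin c₁) (Fin k₁) ℝ) (N₁₂ : Matrix (Fin c₁) (Fin k₂) ℝ)
    (N₁₃ : Matrix (Fin c₁) (Fin k₃) ℝ) (N₂₂ : Matrix (Fin c₂) (Fin k₂) ℝ)
    (N₂₃ : Matrix (Fin c₂) (Fin k₃) ℝ) (N₃₃ : Matrix (Fin c₃) (Fin k₃) ℝ) :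
    upperBlocks M₁₁ M₁₂ M₁₃ M₂₂ M₂₃ M₃₃ * upperBlocks N₁₁ N₁₂ N₁₃ N₂₂ N₂₃ N₃₃ =
      upperBlocks (M₁₁ * N₁₁) (M₁₁ * N₁₂ + M₁₂ * N₂₂) (M₁₁ * N₁₃ + M₁₂ * N₂₃ + M₁₃ * N₃₃)
        (M₂₂ * N₂₂) (M₂₂ * N₂₃ + M₂₃ * N₃₃) (M₃₃ * N₃₃) := by
  ext (i | i | i) (j | j | j) <;>
    simp [upperBlocks, fromBlocks_multiply, Matrix.mul_fromCols, fromCols_mul_fromBlocks, add_assoc]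

theorem upperBlocks_add {r₁ r₂ r₃ c₁ c₂ c₃ : ℕ}
    (M₁₁ N₁₁ : Matrix (Fin r₁) (Fin c₁) ℝ) (M₁₂ N₁₂ : Matrix (Fin r₁) (Fin c₂) ℝ)
    (M₁₃ N₁₃ : Matrix (Fin r₁) (Fin c₃) ℝ) (M₂₂ N₂₂ : Matrix (Fin r₂) (Fin c₂) ℝ)
    (M₂₃ N₂₃ : Matrix (Fin r₂) (Fin c₃) ℝ) (M₃₃ N₃₃ : Matrix (Fin r₃) (Fin c₃) ℝ) :
    upperBlocks M₁₁ M₁₂ M₁₃ M₂₂ M₂₃ M₃₃ + upperBlocks N₁₁ N₁₂ N₁₃ N₂₂ N₂₃ N₃₃ =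
      upperBlocks (M₁₁ + N₁₁) (M₁₂ + N₁₂) (M₁₃ + N₁₃) (M₂₂ + N₂₂) (M₂₃ + N₂₃) (M₃₃ + N₃₃) := by
  ext (i | i | i) (j | j | j) <;> simp [upperBlocks]

theorem isUnit_upperBlocks_one {r₁ r₂ r₃ : ℕ} (M₁₂ : Matrix (Fin r₁) (Fin r₂) ℝ)
    (M₁₃ : Matrix (Fin r₁) (Fin r₃) ℝ) (M₂₃ : Matrix (Fin r₂) (Fin r₃) ℝ) :
    IsUnit (upperBlocks (1 : Matrix (Fin r₁) (Fin r₁) ℝ) M₁₂ M₁₃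
      (1 : Matrix (Fin r₂) (Fin r₂) ℝ) M₂₃ (1 : Matrix (Fin r₃) (Fin r₃) ℝ)) := by
  simp [upperBlocks, Matrix.isUnit_fromBlocks_zero₂₁]

theorem DAESystem.pFeedbackEquivVia_one_of_eq {ℓ n m : ℕ} {sys₁ sys₂ : DAESystem ℓ n m}
    {S : GL (Fin ℓ) ℝ} {T : GL (Fin n) ℝ} {F : Matrix (Fin m) (Fin n) ℝ}
    (hE : sys₁.E = S.val * sys₂.E * T.val)
    (hA : sys₁.A = S.val * sys₂.A * T.val + S.val * sys₂.B * F)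
    (hB : sys₁.B = S.val * sys₂.B) : sys₁.PFeedbackEquivVia sys₂ S T 1 F := by
  have hone : (1 : Matrix (Fin m) (Fin m) ℝ).map (C : ℝ →+* ℝ[X]) = 1 := by
    simp [Matrix.map_one]
  rw [PFeedbackEquivVia, pencil, pencil, hE, hA, hB, Matrix.mul_fromCols, fromBlocks_map,
    fromCols_mul_fromBlocks]
  congr 1
  · simp only [Matrix.map_add _ (map_add C), Matrix.map_mul, Matrix.mul_sub, Matrix.sub_mul,
      Matrix.mul_smul, Matrix.smul_mul, Matrix.mul_neg, Matrix.neg_mul]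
    abel
  · simp [hone, Matrix.map_mul]

/-- The matrix equations that decouple a quasi P-feedback form. -/
theorem QPFFDiag.Admissible.exists_decoupling {d : QPFFSizes} {D : QPFFDiag d} (hD : D.Admissible)
    (O : QPFFOff d) :
    ∃ (S₁₂ : Matrix (Fin d.ℓ₁) (Fin d.n₂) ℝ) (S₁₃ : Matrix (Fin d.ℓ₁) (Fin d.ℓ₃) ℝ)
      (S₂₃ : Matrix (Fin d.n₂) (Fin d.ℓ₃) ℝ) (T₁₂ : Matrix (Fin d.n₁) (Fin d.n₂) ℝ)
      (T₁₃ : Matrix (Fin d.n₁) (Fin d.n₃) ℝ) (T₂₃ : Matrix (Fin d.n₂) (Fin d.n₃) ℝ)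
      (F₁₂ : Matrix (Fin d.m₁) (Fin d.n₂) ℝ),
      O.E₁₂ = D.sys₁₁.E * T₁₂ + S₁₂ * D.E₂₂ ∧
      O.A₁₂ = D.sys₁₁.A * T₁₂ + S₁₂ * D.A₂₂ + D.sys₁₁.B * F₁₂ ∧
      O.E₂₃ = D.E₂₂ * T₂₃ + S₂₃ * D.sys₃₃.E ∧
      O.A₂₃ = D.A₂₂ * T₂₃ + S₂₃ * D.sys₃₃.A ∧
      S₂₃ * D.sys₃₃.B = 0 ∧
      O.E₁₃ = D.sys₁₁.E * T₁₃ + S₁₂ * D.E₂₂ * T₂₃ + S₁₃ * D.sys₃₃.E ∧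
      O.A₁₃ = D.sys₁₁.A * T₁₃ + S₁₂ * D.A₂₂ * T₂₃ + S₁₃ * D.sys₃₃.A ∧
      O.B₁₃ = S₁₃ * D.sys₃₃.B := by
  obtain ⟨U, hU⟩ := hD.isUnit_E₂₂
  set V : Matrix (Fin d.n₂) (Fin d.n₂) ℝ := U⁻¹.val
  have hUV : D.E₂₂ * V = 1 := by rw [← hU]; exact U.mul_inv
  have hVU : V * D.E₂₂ = 1 := by rw [← hU]; exact U.inv_mul
  obtain ⟨P, hP⟩ := Matrix.mulVec_surjective_iff_exists_right_inverse.1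
    (Matrix.mulVec_surjective_of_rank_eq (A := D.sys₁₁.E)
      (hD.rank_E₁₁.trans (Fintype.card_fin _).symm))
  -- Solvability for the third diagonal block.
  have solve₃ : ∀ {k : ℕ} (M : Matrix (Fin k) (Fin k) ℝ) (R : Matrix (Fin k) (Fin d.n₃) ℝ)
      (Q : Matrix (Fin k) (Fin d.m₃) ℝ), ∃ X : Matrix (Fin k) (Fin d.ℓ₃) ℝ,
      X * D.sys₃₃.A - M * X * D.sys₃₃.E = R ∧ X * D.sys₃₃.B = Q := by
    intro k M R Q
    -- Giving `B₃₃` a zero coefficient at `μ` makes `X B₃₃ = Q` extra columns of one Sylvester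
    -- equation whose pencil is `[μ E₃₃ - A₃₃, B₃₃]`.
    obtain ⟨X, hX⟩ := exists_mul_sub_mul_mul_eq (A := fromCols D.sys₃₃.A (-D.sys₃₃.B))
      (E := fromCols D.sys₃₃.E 0) (fun μ => by
        rw [Fintype.card_sum, Fintype.card_fin, Fintype.card_fin, ← hD.rank_pencil₃₃ μ]
        congr 1
        ext i (j | j) <;> simp [DAESystem.complexPencil]) M (fromCols R (-Q))
    refine ⟨X, ?_, ?_⟩
    · ext i j
      simpa [Matrix.mul_fromCols] using congrFun (congrFun hX i) (Sum.inl j)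
    · ext i j
      simpa [Matrix.mul_fromCols] using congrFun (congrFun hX i) (Sum.inr j)
  -- Solvability for the first diagonal block.
  have solve₁ : ∀ (M : Matrix (Fin d.n₂) (Fin d.n₂) ℝ) (R : Matrix (Fin d.ℓ₁) (Fin d.n₂) ℝ),
      ∃ (T : Matrix (Fin d.n₁) (Fin d.n₂) ℝ) (F : Matrix (Fin d.m₁) (Fin d.n₂) ℝ),
      D.sys₁₁.A * T - D.sys₁₁.E * T * M + D.sys₁₁.B * F = R := by
    intro M R
    -- Full row rank of the first pencil is full column rank of its transpose.
    obtain ⟨X, hX⟩ := exists_mul_sub_mul_mul_eq (A := (fromCols D.sys₁₁.A (-D.sys₁₁.B))ᵀ)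
      (E := (fromCols D.sys₁₁.E 0)ᵀ) (fun μ => by
        rw [Fintype.card_fin]
        refine Eq.trans ?_ (hD.rank_pencil₁₁ μ)
        rw [← Matrix.rank_transpose (D.sys₁₁.complexPencil μ)]
        congr 1
        ext (i | i) j <;> simp [DAESystem.complexPencil]) Mᵀ Rᵀ
    have hX' : fromCols D.sys₁₁.A (-D.sys₁₁.B) * Xᵀ -
        fromCols D.sys₁₁.E (0 : Matrix (Fin d.ℓ₁) (Fin d.m₁) ℝ) * (Xᵀ * M) = R := by
      have := congrArg Matrix.transpose hX
      simpa [Matrix.transpose_mul, Matrix.transpose_sub, Matrix.mul_assoc] using this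
    refine ⟨Xᵀ.toRows₁, -Xᵀ.toRows₂, ?_⟩
    rw [← hX']
    conv_rhs => rw [← Matrix.fromRows_toRows Xᵀ]
    rw [Matrix.fromRows_mul, Matrix.fromCols_mul_fromRows, Matrix.fromCols_mul_fromRows]
    simp only [Matrix.zero_mul, add_zero, Matrix.mul_neg, Matrix.neg_mul, Matrix.mul_assoc]
    abel
  obtain ⟨T₁₂, F₁₂, h₁₂⟩ := solve₁ (V * D.A₂₂) (O.A₁₂ - O.E₁₂ * V * D.A₂₂)
  obtain ⟨S₂₃, h₂₃, h₂₃'⟩ := solve₃ (D.A₂₂ * V) (O.A₂₃ - D.A₂₂ * V * O.E₂₃) 0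
  set S₁₂ := (O.E₁₂ - D.sys₁₁.E * T₁₂) * V with hS₁₂
  set T₂₃ := V * (O.E₂₃ - S₂₃ * D.sys₃₃.E) with hT₂₃
  set E' := O.E₁₃ - S₁₂ * D.E₂₂ * T₂₃ with hE'
  -- Position (1,3) comes last, as its right-hand side contains `S₁₂` and `T₂₃`. The choice `T₁₃ = P
  -- (E' - S₁₃ E₃₃)` settles the `E`-equation because `E₁₁ P = 1`, so no feedback is needed here.
  obtain ⟨S₁₃, h₁₃, h₁₃'⟩ := solve₃ (D.sys₁₁.A * P)
    (O.A₁₃ - S₁₂ * D.A₂₂ * T₂₃ - D.sys₁₁.A * P * E') O.B₁₃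
  refine ⟨S₁₂, S₁₃, S₂₃, T₁₂, P * (E' - S₁₃ * D.sys₃₃.E), T₂₃, F₁₂, ?_, ?_, ?_, ?_, h₂₃', ?_, ?_,
    h₁₃'.symm⟩
  · rw [hS₁₂, Matrix.mul_assoc _ V, hVU, Matrix.mul_one]
    abel
  -- After substituting the eliminated unknown, the residual of the `A`-equation is the negative of
  -- the Sylvester residual.
  · rw [← sub_eq_zero, ← neg_eq_zero, ← sub_eq_zero.2 h₁₂, hS₁₂]
    simp only [Matrix.sub_mul, Matrix.mul_assoc]
    abel
  · rw [hT₂₃, ← Matrix.mul_assoc, hUV, Matrix.one_mul]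
    abel
  · rw [← sub_eq_zero, ← neg_eq_zero, ← sub_eq_zero.2 h₂₃, hT₂₃]
    simp only [Matrix.mul_sub, Matrix.mul_assoc]
    abel
  · rw [← Matrix.mul_assoc, hP, Matrix.one_mul, hE']
    abel
  · rw [← sub_eq_zero, ← neg_eq_zero, ← sub_eq_zero.2 h₁₃]
    simp only [Matrix.mul_sub, Matrix.mul_assoc]
    abel

/-- Every system in quasi P-feedback form is P-feedback equivalent, with `V = I`, to a system in
decoupled quasi P-feedback form with the same diagonal blocks. -/
theorem proposition3p10 {ℓ n m : ℕ} (sys : DAESystem ℓ n m) {d : QPFFSizes} (D : QPFFDiag d)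
    (hsys : sys.IsQPFFWith D) :
    ∃ dec : DAESystem ℓ n m, dec.IsDecoupledQPFFWith D ∧
      ∃ (S : GL (Fin ℓ) ℝ) (T : GL (Fin n) ℝ) (F : Matrix (Fin m) (Fin n) ℝ),
        sys.PFeedbackEquivVia dec S T 1 F := by
  obtain ⟨hD, O, hℓ, hn, hm, rfl⟩ := hsys
  refine ⟨D.assemble (QPFFOff.zero d) hℓ hn hm, ⟨hD, hℓ, hn, hm, rfl⟩, ?_⟩
  obtain ⟨S₁₂, S₁₃, S₂₃, T₁₂, T₁₃, T₂₃, F₁₂, hE₁₂, hA₁₂, hE₂₃, hA₂₃, hB₂₃, hE₁₃, hA₁₃, hB₁₃⟩ :=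
    hD.exists_decoupling O
  obtain ⟨S, hS⟩ := (Matrix.isUnit_submatrix_equiv (splitThree hℓ) (splitThree hℓ)).2
    (isUnit_upperBlocks_one S₁₂ S₁₃ S₂₃)
  obtain ⟨T, hT⟩ := (Matrix.isUnit_submatrix_equiv (splitThree hn) (splitThree hn)).2
    (isUnit_upperBlocks_one T₁₂ T₁₃ T₂₃)
  let F₀ : Matrix (Fin d.m₁ ⊕ (Fin d.m₂ ⊕ Fin d.m₃)) (Fin d.n₁ ⊕ (Fin d.n₂ ⊕ Fin d.n₃)) ℝ :=
    upperBlocks 0 F₁₂ 0 0 0 0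
  refine ⟨S, T, F₀.submatrix (splitThree hm) (splitThree hn),
    DAESystem.pFeedbackEquivVia_one_of_eq ?_ ?_ ?_⟩
  · simp [QPFFDiag.assemble, QPFFOff.zero, hS, hT, Matrix.submatrix_mul_equiv, upperBlocks_mul,
      hE₁₂, hE₁₃, hE₂₃]
  · have hadd (M N : Matrix (Fin d.ℓ₁ ⊕ (Fin d.n₂ ⊕ Fin d.ℓ₃))
        (Fin d.n₁ ⊕ (Fin d.n₂ ⊕ Fin d.n₃)) ℝ) :
        M.submatrix (splitThree hℓ) (splitThree hn) + N.submatrix (splitThree hℓ) (splitThree hn) =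
          (M + N).submatrix (splitThree hℓ) (splitThree hn) := rfl
    simp [QPFFDiag.assemble, QPFFOff.zero, hS, hT, F₀, Matrix.submatrix_mul_equiv,
      upperBlocks_mul, hadd, upperBlocks_add, hA₁₂, hA₁₃, hA₂₃]
  · simp [QPFFDiag.assemble, QPFFOff.zero, hS, Matrix.submatrix_mul_equiv, upperBlocks_mul,
      hB₁₃, hB₂₃]
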